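/- Let $\mathcal T$ be a triangulated category. For a full subcategory $\mathcal I\subset\mathcal T$ let $\langle\mathcal I\rangle$ be the smallest full subcategory of $\mathcal T$ that contains $\mathcal I$ and is closed under finite direct sums, direct summands and shifts. For full subcategories $\mathcal I_1,\mathcal I_2$ let $\mathcal I_1*\mathcal I_2$ be the full subcategory of all objects $M$ that fit into a distinguished triangle $M_1\to M\to M_2\to M_1[1]$ with $M_i\in\mathcal I_i$, and put $\mathcal I_1\diamond\mathcal I_2=\langle\mathcal I_1*\mathcal I_2\rangle$. For an object $E$ let $\langle E\rangle_0$ consist of the zero objects, let $\langle E\rangle_1=\langle\{E\}\rangle$, and let $\langle E\rangle_{n+1}=\langle E\rangle_{n}\diamond\langle E\rangle_1$ for $n\ge 1$. The object $E$ is a strong generator if $\langle E\rangle_n=\mathcal T$ for some $n\in\mathbb N$. The dimension spectrum $\sigma(\mathcal T)\subset\mathbb Z$ is the set of all integers $d\ge 0$ for which there is an object $E\in\mathcal T$ with $\langle E\rangle_{d+1}=\mathcal T$ and $\langle E\rangle_d\ne\mathcal T$. **Proposition.** Let $C$ be a smooth affine curve over a field $k$, that is, an integral affine scheme that is smooth of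 relative dimension $1$ over $\operatorname{Spec} k$. Let $D^b(\operatorname{coh} C)$ be the bounded derived category of the abelian category of coherent sheaves on $C$. Then $$\sigma\bigl(D^b(\operatorname{coh} C)\bigr)=\{1\}.$$ Moreover, every strong generator $E$ of $D^b(\operatorname{coh} C)$ satisfies $\langle E\rangle_2=D^b(\operatorname{coh} C)$ and $\langle E\rangle_1\ne D^b(\operatorname{coh} C)$. -/

import Mathlib

open CategoryTheory Limits AlgebraicGeometry

universe u

/-! ## Generation in triangulated categories -/

namespace TriangGen

open Pretriangulated

variable {T : Type*} [Category T] [HasZeroObject T] [HasShift T ℤ] [Preadditive T]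
  [∀ n : ℤ, (shiftFunctor T n).Additive] [Pretriangulated T]

/-- `⟨I⟩`: the smallest full subcategory containing `I` and closed under finite direct sums
(including the empty one), direct summands and shifts. Closure under isomorphisms is a special case
of closure under direct summands. -/
inductive bracket (I : ObjectProperty T) : ObjectProperty T
  | of_mem {X : T} (hX : I X) : bracket I X
  | zero {X : T} (hX : IsZero X) : bracket I X
  | sum {X Y : T} (hX : bracket I X) (hY : bracket I Y) : bracket I (X ⊞ Y)
  | summand {X Y : T} (r : Retract X Y) (hY : bracket I Y) : bracket I X
  | shift {X : T} (n : ℤ) (hX : bracket I X) : bracket I (X⟦n⟧)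

/-- `I₁ ◇ I₂ = ⟨I₁ * I₂⟩`, where `I₁ * I₂` is the full subcategory of all `M` that fit into a
distinguished triangle `M₁ ⟶ M ⟶ M₂ ⟶ M₁⟦1⟧` with `M₁` in `I₁` and `M₂` in `I₂`. -/
def diamond (I₁ I₂ : ObjectProperty T) : ObjectProperty T :=
  bracket (ObjectProperty.extensionProduct I₁ I₂)

/-- `⟨E⟩_n`: one has `⟨E⟩_1 = ⟨E⟩` and `⟨E⟩_{n+1} = ⟨E⟩_n ◇ ⟨E⟩_1` for `n ≥ 1`; by the usual
convention `⟨E⟩_0` consists of the zero objects. -/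
def step (E : T) : ℕ → ObjectProperty T
  | 0 => fun X ↦ IsZero X
  | 1 => bracket (ObjectProperty.singleton E)
  | n + 2 => diamond (step E (n + 1)) (bracket (ObjectProperty.singleton E))

/-- `E` is a strong generator if `⟨E⟩_n` is the whole category for some natural number `n`. -/
def IsStrongGenerator (E : T) : Prop := ∃ n : ℕ, step E n = ⊤

variable (T) in
/-- The dimension spectrum: the set of all integers `d ≥ 0` for which there is an object `E`
such that `⟨E⟩_{d+1}` is the whole category and `⟨E⟩_d` is not. -/
def dimensionSpectrum : Set ℤ :=
  {d | ∃ n : ℕ, d = n ∧ ∃ E : T, step E (n + 1) = ⊤ ∧ step E n ≠ ⊤}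

end TriangGen

/-! ## Coherent sheaves -/

namespace CoherentSheaf

/-- An `𝒪_X`-module is coherent if it is quasi-coherent and its sections over every affine open `U`
form a finitely generated `Γ(X, U)`-module (the standard notion on locally Noetherian schemes). -/
def isCoherent (X : Scheme.{u}) : ObjectProperty X.Modules := fun M ↦
  M.IsQuasicoherent ∧ ∀ U : X.Opens, IsAffineOpen U → Module.Finite Γ(X, U) Γ(M, U)

/-- The category `coh X` of coherent sheaves, a full subcategory of the category of
`𝒪_X`-modules. -/
abbrev Coh (X : Scheme.{u}) := (isCoherent X).FullSubcategory

/-! The rest of this section shows that `coh X` is an abelian category when `X` is affine and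
Noetherian, being closed under kernels, cokernels and finite products. -/

theorem tilde_map_app_injective {R : CommRingCat.{u}} {M N : ModuleCat.{u} R} (f : M ⟶ N)
    (hf : Function.Injective f.hom) (U : (Spec R).Opens) :
    Function.Injective (((tilde.functor R).map f).app U) := by
  intro s t h
  refine Subtype.ext (funext fun x ↦ ?_)
  have h2 := congrArg Subtype.val h
  have h3 := congrFun h2 x
  have : x.1.asIdeal.IsPrime := PrimeSpectrum.isPrime x.1
  exact IsLocalizedModule.map_injective x.1.asIdeal.primeCompl
    (LocalizedModule.mkLinearMap x.1.asIdeal.primeCompl M)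
    (LocalizedModule.mkLinearMap x.1.asIdeal.primeCompl N) f.hom hf h3

theorem mono_of_app_injective {X : Scheme.{u}} {M N : X.Modules} (f : M ⟶ N)
    (h : ∀ U, Function.Injective (f.app U)) : Mono f := by
  constructor
  intro Z a b hab
  apply Scheme.Modules.hom_ext
  intro U
  ext z
  apply h U
  have := congrArg (fun φ => (Scheme.Modules.Hom.app φ U) z) hab
  simpa using this

theorem app_injective {X : Scheme.{u}} {M N : X.Modules} (f : M ⟶ N) [Mono f]
    (U : X.Opens) : Function.Injective (f.app U) := by
  have : Mono ((Scheme.Modules.toPresheaf X).map f) := inferInstance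
  have : Mono (((Scheme.Modules.toPresheaf X).map f).app (.op U)) := inferInstance
  exact (AddCommGrpCat.mono_iff_injective _).1 this

instance tilde_preservesMono (R : CommRingCat.{u}) : (tilde.functor R).PreservesMonomorphisms where
  preserves f _ := mono_of_app_injective _ fun U ↦
    tilde_map_app_injective f ((ModuleCat.mono_iff_injective f).1 inferInstance) U

instance tilde_preservesFiniteLimits (R : CommRingCat.{u}) :
    PreservesFiniteLimits (tilde.functor R) := by
  have := Functor.preservesHomology_of_preservesMonos_and_cokernels (tilde.functor R)
  exact Functor.preservesFiniteLimits_of_preservesHomology _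

theorem isQuasicoherent_of_iso {X : Scheme.{u}} {M N : X.Modules} (e : M ≅ N)
    (h : M.IsQuasicoherent) : N.IsQuasicoherent :=
  (SheafOfModules.isQuasicoherent X.ringCatSheaf).prop_of_iso e h

theorem exists_tilde {R : CommRingCat.{u}} (M : (Spec R).Modules) (h : M.IsQuasicoherent) :
    ∃ N : ModuleCat.{u} R, Nonempty ((tilde.functor R).obj N ≅ M) := by
  have : (tilde.functor R).essImage M := by
    rw [essImage_tilde]; exact h
  exact this

/-- An isomorphism of schemes induces an equivalence between their categories of modules. -/
noncomputable def modulesEquiv {X Y : Scheme.{u}} (e : X ≅ Y) : Y.Modules ≌ X.Modules :=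
  CategoryTheory.Equivalence.mk (Scheme.Modules.restrictFunctor e.hom)
    (Scheme.Modules.restrictFunctor e.inv)
    (Scheme.Modules.restrictFunctorId.symm ≪≫
      Scheme.Modules.restrictFunctorCongr (e.inv_hom_id).symm ≪≫
      Scheme.Modules.restrictFunctorComp e.inv e.hom)
    ((Scheme.Modules.restrictFunctorComp e.hom e.inv).symm ≪≫
      Scheme.Modules.restrictFunctorCongr e.hom_inv_id ≪≫ Scheme.Modules.restrictFunctorId)

theorem exists_tilde_diagram {R : CommRingCat.{u}} {J : Type*} [Category J]
    (F : J ⥤ (Spec R).Modules) (hF : ∀ j, (F.obj j).IsQuasicoherent) :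
    ∃ G : J ⥤ ModuleCat.{u} R, Nonempty (G ⋙ tilde.functor R ≅ F) :=
  let F' : J ⥤ (SheafOfModules.isQuasicoherent (Spec R).ringCatSheaf).FullSubcategory :=
    ObjectProperty.lift _ F hF
  ⟨F' ⋙ tildeEquiv.inverse,
    ⟨Functor.isoWhiskerRight (Functor.isoWhiskerLeft F' tildeEquiv.counitIso)
      (SheafOfModules.isQuasicoherent (Spec R).ringCatSheaf).ι⟩⟩

theorem isQuasicoherent_limit_Spec {R : CommRingCat.{u}} {J : Type} [SmallCategory J]
    [FinCategory J] {F : J ⥤ (Spec R).Modules} {c : Cone F} (hc : IsLimit c)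
    (hF : ∀ j, (F.obj j).IsQuasicoherent) : c.pt.IsQuasicoherent := by
  obtain ⟨G, ⟨e⟩⟩ := exists_tilde_diagram F hF
  have h := isLimitOfPreserves (tilde.functor R) (limit.isLimit G)
  exact isQuasicoherent_of_iso (h.conePointsIsoOfNatIso hc e)
    (inferInstanceAs ((tilde.functor R).obj _).IsQuasicoherent)

theorem isQuasicoherent_colimit_Spec {R : CommRingCat.{u}} {J : Type} [SmallCategory J]
    [FinCategory J] {F : J ⥤ (Spec R).Modules} {c : Cocone F} (hc : IsColimit c)
    (hF : ∀ j, (F.obj j).IsQuasicoherent) : c.pt.IsQuasicoherent := by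
  obtain ⟨G, ⟨e⟩⟩ := exists_tilde_diagram F hF
  have : PreservesColimitsOfShape J (tilde.functor R) := inferInstance
  have h := isColimitOfPreserves (tilde.functor R) (colimit.isColimit G)
  exact isQuasicoherent_of_iso (h.coconePointsIsoOfNatIso hc e)
    (inferInstanceAs ((tilde.functor R).obj _).IsQuasicoherent)

theorem isQuasicoherent_iff_Spec {X : Scheme.{u}} [IsAffine X] (M : X.Modules) :
    M.IsQuasicoherent ↔ ((modulesEquiv X.isoSpec.symm).functor.obj M).IsQuasicoherent :=
  ⟨fun _ ↦ inferInstanceAs ((Scheme.Modules.restrictFunctor _).obj M).IsQuasicoherent,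
   fun _ ↦ isQuasicoherent_of_iso ((modulesEquiv X.isoSpec.symm).unitIso.app M).symm
    (Scheme.Modules.isQuasicoherent_restrictFunctor X.isoSpec.hom _)⟩

theorem isQuasicoherent_limit {X : Scheme.{u}} [IsAffine X] {J : Type} [SmallCategory J]
    [FinCategory J] {F : J ⥤ X.Modules} {c : Cone F} (hc : IsLimit c)
    (hF : ∀ j, (F.obj j).IsQuasicoherent) : c.pt.IsQuasicoherent := by
  rw [isQuasicoherent_iff_Spec]
  exact isQuasicoherent_limit_Spec (isLimitOfPreserves (modulesEquiv X.isoSpec.symm).functor hc)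
    fun j ↦ (isQuasicoherent_iff_Spec _).1 (hF j)

theorem isQuasicoherent_colimit {X : Scheme.{u}} [IsAffine X] {J : Type} [SmallCategory J]
    [FinCategory J] {F : J ⥤ X.Modules} {c : Cocone F} (hc : IsColimit c)
    (hF : ∀ j, (F.obj j).IsQuasicoherent) : c.pt.IsQuasicoherent := by
  rw [isQuasicoherent_iff_Spec]
  exact isQuasicoherent_colimit_Spec
    (isColimitOfPreserves (modulesEquiv X.isoSpec.symm).functor hc)
    fun j ↦ (isQuasicoherent_iff_Spec _).1 (hF j)

theorem app_top_surjective_Spec {R : CommRingCat.{u}} {M N : (Spec R).Modules} (p : M ⟶ N) [Epi p]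
    (hM : M.IsQuasicoherent) (hN : N.IsQuasicoherent) :
    Function.Surjective (p.app ⊤) := by
  obtain ⟨M', ⟨eM⟩⟩ := exists_tilde M hM
  obtain ⟨N', ⟨eN⟩⟩ := exists_tilde N hN
  let g : M' ⟶ N' := (tilde.functor R).preimage (eM.hom ≫ p ≫ eN.inv)
  have hg : (tilde.functor R).map g = eM.hom ≫ p ≫ eN.inv := (tilde.functor R).map_preimage _
  have : Epi ((tilde.functor R).map g) := by rw [hg]; infer_instance
  have hg' : Epi g := (tilde.functor R).epi_of_epi_map this
  have hp : p = eM.inv ≫ (tilde.functor R).map g ≫ eN.hom := by rw [hg]; simp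
  have : Epi (moduleSpecΓFunctor.map ((tilde.functor R).map g)) :=
    ((MorphismProperty.epimorphisms _).arrow_mk_iso_iff
      (((Functor.mapArrowFunctor _ _).mapIso tilde.toTildeΓNatIso).app (Arrow.mk g))).1 hg'
  have : Epi (moduleSpecΓFunctor.map p) := by rw [hp]; simp only [Functor.map_comp]; infer_instance
  have hs : Function.Surjective (moduleSpecΓFunctor.map p).hom :=
    (ModuleCat.epi_iff_surjective _).1 this
  exact hs

/-- An epimorphism of quasi-coherent sheaves is surjective on sections over affine opens. -/
theorem app_surjective {X : Scheme.{u}} {M N : X.Modules} (p : M ⟶ N) [Epi p]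
    (hM : M.IsQuasicoherent) (hN : N.IsQuasicoherent) {U : X.Opens} (hU : IsAffineOpen U) :
    Function.Surjective (p.app U) := by
  have h := app_top_surjective_Spec ((Scheme.Modules.restrictFunctor hU.fromSpec).map p)
    inferInstance inferInstance
  have h' : Function.Surjective (p.app (hU.fromSpec ''ᵁ ⊤)) := h
  have e : hU.fromSpec ''ᵁ ⊤ = U := by simp
  rwa [e] at h'

theorem finite_of_injective {X : Scheme.{u}} {M N : X.Modules} (f : M ⟶ N) {U : X.Opens}
    [IsNoetherianRing Γ(X, U)] [Module.Finite Γ(X, U) Γ(N, U)] (h : Function.Injective (f.app U)) :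
    Module.Finite Γ(X, U) Γ(M, U) :=
  let φ : Γ(M, U) →ₗ[Γ(X, U)] Γ(N, U) :=
    { __ := (f.app U).hom, map_smul' r x := Scheme.Modules.Hom.app_smul f r x }
  Module.Finite.of_injective φ h

theorem finite_of_surjective {X : Scheme.{u}} {M N : X.Modules} (f : M ⟶ N) {U : X.Opens}
    [Module.Finite Γ(X, U) Γ(M, U)] (h : Function.Surjective (f.app U)) :
    Module.Finite Γ(X, U) Γ(N, U) :=
  let φ : Γ(M, U) →ₗ[Γ(X, U)] Γ(N, U) :=
    { __ := (f.app U).hom, map_smul' r x := Scheme.Modules.Hom.app_smul f r x }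
  Module.Finite.of_surjective φ h

variable (X : Scheme.{u}) [IsAffine X] [IsLocallyNoetherian X]

instance : (isCoherent X).IsClosedUnderKernels where
  kernels_le := by
    rintro _ ⟨f, k, hk, hf⟩
    refine ⟨isQuasicoherent_limit hk ?_, fun U hU ↦ ?_⟩
    · rintro (_ | _)
      exacts [hf.1.1, hf.2.1]
    · have : IsNoetherianRing Γ(X, U) := IsLocallyNoetherian.component_noetherian ⟨U, hU⟩
      have := hf.1.2 U hU
      have := Fork.IsLimit.mono hk
      exact finite_of_injective k.ι (app_injective k.ι U)

instance : (isCoherent X).IsClosedUnderCokernels where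
  cokernels_le := by
    rintro _ ⟨f, k, hk, hf⟩
    have h : k.pt.IsQuasicoherent := isQuasicoherent_colimit hk (by
      rintro (_ | _)
      exacts [hf.1.1, hf.2.1])
    refine ⟨h, fun U hU ↦ ?_⟩
    have := hf.2.2 U hU
    have := Cofork.IsColimit.epi hk
    exact finite_of_surjective k.π (app_surjective k.π hf.2.1 h hU)

instance : (isCoherent X).IsClosedUnderFiniteProducts where
  isClosedUnderLimitsOfShape J _ := ⟨by
    rintro M ⟨p⟩
    have := Fintype.ofFinite J
    refine ⟨isQuasicoherent_limit p.isLimit fun j ↦ (p.prop_diag_obj j).1, fun U hU ↦ ?_⟩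
    have : IsNoetherianRing Γ(X, U) := IsLocallyNoetherian.component_noetherian ⟨U, hU⟩
    have (j : J) := (p.prop_diag_obj ⟨j⟩).2 U hU
    let φ : Γ(M, U) →ₗ[Γ(X, U)] ∀ j : J, Γ(p.diag.obj ⟨j⟩, U) := LinearMap.pi fun j ↦
      { __ := ((p.π.app ⟨j⟩).app U).hom
        map_smul' r x := Scheme.Modules.Hom.app_smul (p.π.app ⟨j⟩) r x }
    refine Module.Finite.of_injective φ fun x y h ↦ ?_
    have : PreservesLimitsOfSize.{0, 0} (Scheme.Modules.toPresheaf X) :=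
      preservesLimitsOfSize_shrink.{0, u, 0, u} _
    have hl := isLimitOfPreserves ((evaluation _ _).obj (.op U))
      (isLimitOfPreserves (Scheme.Modules.toPresheaf X) p.isLimit)
    exact Concrete.isLimit_ext _ hl x y fun j ↦ congrFun h j.as⟩

instance : (isCoherent X).ContainsZero where
  exists_zero := ⟨⊤_ X.Modules, (isZero_zero _).of_iso HasZeroObject.zeroIsoTerminal.symm,
    (isCoherent X).prop_terminal⟩

noncomputable instance : HasDerivedCategory (Coh X) := HasDerivedCategory.standard _

/-- The bounded derived category `D^b(coh X)` of coherent sheaves on the affine Noetherian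
scheme `X`: the full triangulated subcategory of bounded objects in the derived category of
`coh X`. -/
abbrev DbCoh := DerivedCategory.Bounded (Coh X)

end CoherentSheaf

/-! ## Smooth affine curves -/

/-- A smooth affine curve over the field `k`: an integral affine scheme with a structure morphism
to `Spec k` that is smooth of relative dimension one. -/
structure SmoothAffineCurve (k : Type u) [Field k] where
  /-- the underlying scheme -/
  toScheme : Scheme.{u}
  /-- the structure morphism -/
  hom : toScheme ⟶ Spec (.of k)
  isAffine : IsAffine toScheme
  isIntegral : IsIntegral toScheme
  smooth : SmoothOfRelativeDimension 1 hom

namespace SmoothAffineCurve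

variable {k : Type u} [Field k] (C : SmoothAffineCurve k)

instance : IsAffine C.toScheme := C.isAffine

instance : IsIntegral C.toScheme := C.isIntegral

instance : SmoothOfRelativeDimension 1 C.hom := C.smooth

instance : IsLocallyNoetherian C.toScheme := by
  have : Smooth C.hom := SmoothOfRelativeDimension.smooth 1 C.hom
  have : IsLocallyNoetherian (Spec (.of k)) :=
    isLocallyNoetherian_Spec.2 (inferInstanceAs (IsNoetherianRing k))
  exact LocallyOfFiniteType.isLocallyNoetherian C.hom

end SmoothAffineCurve

/-!
The category of coherent sheaves on the curve is equivalent to that of finitely generated modules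
over `A = Γ(C, ⊤)`. This ring is a Dedekind domain: locally `C` is étale over the affine line, so the
maximal ideals of its local rings are principal. It is not a field, because an algebra that is étale
over a polynomial ring in one variable is not.

*Upper bound.* Every finitely generated `A`-module has a resolution of length one by finitely
generated projective modules, that is, by summands of finite powers of `A`. Hence each object of the
bounded derived category is the direct sum of its shifted homology modules
(`DerivedCategory.Bounded.exists_decomposition`), and each of these is the cone of a morphism between
objects of `⟨A⟩`. So `⟨A⟩_2` is everything.

*Lower bound.* The homology of `E` is finitely generated and vanishes in almost all degrees, so a
single nonzero `b : A` annihilates its torsion, and then `b` annihilates the torsion in the homology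
of every object of `⟨E⟩_1`. For a nonzero nonunit `t` the module `A ⧸ (b t)` is not annihilated by
`b` (`DedekindGen.step_one_ne_top`).

*Arbitrary strong generators.* If the homology of `E` were torsion, then so would be that of every
object of `⟨E⟩_n`. So a strong generator `E` has a homology module that is not torsion. Modulo
torsion this module is a nonzero projective, whose trace ideal is the unit ideal, so that `A` is a
summand of some finite power of it (`ModuleCat.isSummandOfPower_of_not_isTorsion`). As the homology
modules of `E` are summands of shifts of `E`, it follows that `A` lies in `⟨E⟩_1` and that `⟨E⟩_2` is
everything.
-/

/-! ### The coordinate ring of a smooth affine curve -/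

namespace Algebra

/-- At a prime `q` of an algebra which is unramified over `R`, the maximal ideal of the localization
is generated by the contraction of `q` to `R`. -/
theorem isPrincipal_maximalIdeal_of_formallyUnramified (R : Type*) {S : Type*} [CommRing R]
    [CommRing S] [Algebra R S] [IsPrincipalIdealRing R] [EssFiniteType R S]
    [FormallyUnramified R S] (q : Ideal S) [q.IsPrime] :
    (IsLocalRing.maximalIdeal (Localization.AtPrime q)).IsPrincipal := by
  let := Localization.AtPrime.algebraOfLiesOver (q.under R) q
  have : IsUnramifiedAt R q := inferInstance
  rw [← ((isUnramifiedAt_iff_map_eq R (q.under R) q).1 this).2]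
  infer_instance

/-- An algebra that is étale over `K[X]` is not a field. -/
theorem not_isField_of_etale_mvPolynomial {K S : Type*} [Field K] [CommRing S]
    [Algebra (MvPolynomial (Fin 1) K) S] [Etale (MvPolynomial (Fin 1) K) S] : ¬ IsField S := by
  intro h
  let := h.toField
  let : Algebra K S :=
    ((algebraMap (MvPolynomial (Fin 1) K) S).comp (algebraMap K (MvPolynomial (Fin 1) K))).toAlgebra
  have : IsScalarTower K (MvPolynomial (Fin 1) K) S := .of_algebraMap_eq' rfl
  have : FiniteType K S := .trans (S := MvPolynomial (Fin 1) K) inferInstance inferInstance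
  -- By Zariski's lemma a field of finite type over `K` is finite over `K`. So `S` would be integral
  -- over the polynomial ring, which injects into it by flatness and would then itself be a field.
  have : Module.Finite K S := finite_of_finite_type_of_isJacobsonRing K S
  have : Algebra.IsIntegral (MvPolynomial (Fin 1) K) S :=
    Algebra.IsIntegral.tower_top (R := K)
  have : Module.Flat (MvPolynomial (Fin 1) K) S := inferInstance
  have hinj : Function.Injective (algebraMap (MvPolynomial (Fin 1) K) S) :=
    FaithfulSMul.algebraMap_injective _ _
  exact Polynomial.not_isField K (MulEquiv.isField (isField_of_isIntegral_of_isField hinj h)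
    (MvPolynomial.uniqueAlgEquiv K (Fin 1)).symm.toMulEquiv)

end Algebra

namespace AlgebraicGeometry

/-- Locally, a curve that is smooth over a field is étale over the affine line. -/
theorem SmoothOfRelativeDimension.exists_etale_mvPolynomial {K : Type u} [Field K] {X : Scheme.{u}}
    (f : X ⟶ Spec (.of K)) [SmoothOfRelativeDimension 1 f] (x : X) :
    ∃ V : X.Opens, IsAffineOpen V ∧ x ∈ V ∧
      ∃ (L : Type u) (_ : Field L) (g : MvPolynomial (Fin 1) L →+* Γ(X, V)), g.Etale := by
  obtain ⟨U, hU, V, hV, hx, e, h⟩ :=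
    SmoothOfRelativeDimension.exists_isStandardSmoothOfRelativeDimension (n := 1) (f := f) x
  -- The spectrum of a field is a single point.
  obtain rfl : U = ⊤ := by
    ext y
    simpa [Subsingleton.elim y (f x)] using e hx
  have hL : IsField Γ(Spec (.of K), ⊤) :=
    MulEquiv.isField (Field.toIsField K) (Scheme.ΓSpecIso (.of K)).commRingCatIsoToRingEquiv
  let := hL.toField
  obtain ⟨g, -, hg⟩ := h.exists_etale_mvPolynomial
  exact ⟨V, hV, hx, _, this, g, hg⟩

theorem isPrincipal_maximalIdeal_stalk {K : Type u} [Field K] {X : Scheme.{u}}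
    (f : X ⟶ Spec (.of K)) [SmoothOfRelativeDimension 1 f] (x : X) :
    (IsLocalRing.maximalIdeal (X.presheaf.stalk x)).IsPrincipal := by
  obtain ⟨V, hV, hx, L, _, g, hg⟩ := SmoothOfRelativeDimension.exists_etale_mvPolynomial f x
  algebraize [g]
  have : IsPrincipalIdealRing (MvPolynomial (Fin 1) L) :=
    .of_surjective (MvPolynomial.uniqueAlgEquiv L (Fin 1)).symm
      (MvPolynomial.uniqueAlgEquiv L (Fin 1)).symm.surjective
  let := X.presheaf.algebra_section_stalk (⟨x, hx⟩ : V)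
  have := hV.isLocalization_stalk ⟨x, hx⟩
  let q := (hV.primeIdealOf ⟨x, hx⟩).asIdeal
  let e : Localization.AtPrime q ≃ₐ[Γ(X, V)] X.presheaf.stalk x :=
    IsLocalization.algEquiv q.primeCompl _ _
  have h := Algebra.isPrincipal_maximalIdeal_of_formallyUnramified (MvPolynomial (Fin 1) L) q
  have := h.map_ringHom e.toRingHom
  have h2 := IsLocalRing.map_maximalIdeal_of_surjective e.toRingHom e.surjective
  rwa [h2] at this

end AlgebraicGeometry

namespace SmoothAffineCurve

variable {k : Type u} [Field k] (C : SmoothAffineCurve k)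

instance : IsNoetherianRing Γ(C.toScheme, ⊤) :=
  IsLocallyNoetherian.component_noetherian ⟨⊤, isAffineOpen_top _⟩

instance : IsDedekindDomainDvr Γ(C.toScheme, ⊤) where
  is_dvr_at_nonzero_prime p hp _ := by
    have hT := isAffineOpen_top C.toScheme
    let x := hT.fromSpec ⟨p, inferInstance⟩
    let := C.toScheme.presheaf.algebra_section_stalk (⟨x, trivial⟩ : (⊤ : C.toScheme.Opens))
    have : IsLocalization.AtPrime (C.toScheme.presheaf.stalk x) p :=
      hT.isLocalization_stalk' ⟨p, inferInstance⟩ trivial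
    let e : C.toScheme.presheaf.stalk x ≃ₐ[Γ(C.toScheme, ⊤)] Localization.AtPrime p :=
      IsLocalization.algEquiv p.primeCompl _ _
    have h := (isPrincipal_maximalIdeal_stalk C.hom x).map_ringHom e.toRingHom
    have h2 := IsLocalRing.map_maximalIdeal_of_surjective e.toRingHom e.surjective
    rw [h2] at h
    exact ((IsDiscreteValuationRing.TFAE (Localization.AtPrime p)
      (IsLocalization.AtPrime.not_isField _ hp (Localization.AtPrime p))).out 4 0).mp h

theorem isDedekindDomain : IsDedekindDomain Γ(C.toScheme, ⊤) := inferInstance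

theorem not_isField : ¬ IsField Γ(C.toScheme, ⊤) := by
  intro h
  let := h.toField
  -- If the ring were a field, the curve would be a point, so that the étale chart is everything.
  have : Subsingleton C.toScheme :=
    (C.toScheme.isoSpec.schemeIsoToHomeo.toEquiv).subsingleton_congr.2
      (inferInstanceAs (Subsingleton (PrimeSpectrum Γ(C.toScheme, ⊤))))
  let x : C.toScheme := Classical.arbitrary _
  obtain ⟨V, hV, hx, L, _, g, hg⟩ := SmoothOfRelativeDimension.exists_etale_mvPolynomial C.hom x
  obtain rfl : V = ⊤ := by
    ext y
    simpa [Subsingleton.elim y x] using hx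
  algebraize [g]
  exact Algebra.not_isField_of_etale_mvPolynomial (K := L) h

end SmoothAffineCurve

/-! ### Generation in triangulated categories -/

namespace CategoryTheory

variable {C D : Type*} [Category C] [Category D] [Preadditive C] [Preadditive D]

/-- `P` is a direct summand of a finite power of `M`. A retraction of `M ^ n` onto `P` is recorded by
its components, so that no biproducts are needed. -/
def IsSummandOfPower (M P : C) : Prop :=
  ∃ (n : ℕ) (r : Fin n → (P ⟶ M)) (i : Fin n → (M ⟶ P)), ∑ j, r j ≫ i j = 𝟙 P

theorem IsSummandOfPower.map {M P : C} (h : IsSummandOfPower M P) (F : C ⥤ D) [F.Additive] :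
    IsSummandOfPower (F.obj M) (F.obj P) := by
  obtain ⟨n, r, i, h⟩ := h
  refine ⟨n, fun j ↦ F.map (r j), fun j ↦ F.map (i j), ?_⟩
  simp only [← F.map_comp, ← F.map_sum, h, F.map_id]

theorem IsSummandOfPower.of_map {M P : C} (F : C ⥤ D) [F.Additive] [F.Full] [F.Faithful]
    (h : IsSummandOfPower (F.obj M) (F.obj P)) : IsSummandOfPower M P := by
  obtain ⟨n, r, i, h⟩ := h
  refine ⟨n, fun j ↦ F.preimage (r j), fun j ↦ F.preimage (i j), F.map_injective ?_⟩
  simp only [F.map_sum, F.map_comp, F.map_preimage, h, F.map_id]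

theorem IsSummandOfPower.of_iso {M M' P P' : C} (e : M ≅ M') (f : P ≅ P')
    (h : IsSummandOfPower M P) : IsSummandOfPower M' P' := by
  obtain ⟨n, r, i, h⟩ := h
  refine ⟨n, fun j ↦ f.inv ≫ r j ≫ e.hom, fun j ↦ e.inv ≫ i j ≫ f.hom, ?_⟩
  have : f.inv ≫ (∑ j, r j ≫ i j) ≫ f.hom = 𝟙 _ := by simp [h]
  simpa [Preadditive.sum_comp, Preadditive.comp_sum] using this

theorem IsSummandOfPower.projective {M P : C} (h : IsSummandOfPower M P) [Projective M] :
    Projective P where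
  factors {E X} f e _ := by
    obtain ⟨n, r, i, h⟩ := h
    refine ⟨∑ j, r j ≫ Projective.factorThru (i j ≫ f) e, ?_⟩
    rw [Preadditive.sum_comp]
    simp only [Category.assoc, Projective.factorThru_comp]
    simp only [← Category.assoc, ← Preadditive.sum_comp, h, Category.id_comp]

end CategoryTheory

namespace TriangGen

open Pretriangulated ZeroObject

variable {T : Type*} [Category T] [HasZeroObject T] [HasShift T ℤ] [Preadditive T]
  [∀ n : ℤ, (shiftFunctor T n).Additive] [Pretriangulated T]

theorem bracket_of_iso {I : ObjectProperty T} {X Y : T} (e : X ≅ Y) (h : bracket I X) :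
    bracket I Y :=
  .summand e.symm.retract h

theorem bracket_of_shift {I : ObjectProperty T} {X : T} (n : ℤ) (h : bracket I (X⟦n⟧)) :
    bracket I X :=
  bracket_of_iso ((shiftEquiv T n).unitIso.app X).symm (h.shift (-n))

theorem bracket_le {I J : ObjectProperty T} (h : I ≤ bracket J) : bracket I ≤ bracket J := by
  intro X hX
  induction hX with
  | of_mem hX => exact h _ hX
  | zero hX => exact .zero hX
  | sum _ _ h₁ h₂ => exact h₁.sum h₂
  | summand r _ h => exact .summand r h
  | shift n _ h => exact h.shift n

theorem bracket_mono {I J : ObjectProperty T} (h : I ≤ J) : bracket I ≤ bracket J :=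
  bracket_le fun _ hX ↦ .of_mem (h _ hX)

theorem bracket_of_sum_eq_id {I : ObjectProperty T} {ι : Type*} (s : Finset ι) {X : T} {Y : ι → T}
    (hY : ∀ j ∈ s, bracket I (Y j)) (r : ∀ j, X ⟶ Y j) (i : ∀ j, Y j ⟶ X)
    (h : ∑ j ∈ s, r j ≫ i j = 𝟙 X) : bracket I X := by
  classical
  suffices ∀ t ⊆ s, ∃ (Z : T) (a : X ⟶ Z) (b : Z ⟶ X), bracket I Z ∧ a ≫ b = ∑ j ∈ t, r j ≫ i j by
    obtain ⟨Z, a, b, hZ, hab⟩ := this s subset_rfl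
    exact .summand ⟨a, b, hab.trans h⟩ hZ
  intro t
  induction t using Finset.induction_on with
  | empty => exact fun _ ↦ ⟨0, 0, 0, .zero (isZero_zero T), by simp⟩
  | insert j t hj ih =>
    intro hts
    obtain ⟨Z, a, b, hZ, hab⟩ := ih ((Finset.subset_insert _ _).trans hts)
    refine ⟨Y j ⊞ Z, biprod.lift (r j) a, biprod.desc (i j) b,
      .sum (hY j (hts (Finset.mem_insert_self _ _))) hZ, ?_⟩
    rw [biprod.lift_desc, hab, Finset.sum_insert hj]

theorem bracket_of_isSummandOfPower {I : ObjectProperty T} {M P : T} (h : IsSummandOfPower M P)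
    (hM : bracket I M) : bracket I P := by
  obtain ⟨n, r, i, h⟩ := h
  exact bracket_of_sum_eq_id Finset.univ (fun _ _ ↦ hM) r i h

theorem diamond_mono {I I' J J' : ObjectProperty T} (h : I ≤ I') (h' : J ≤ J') :
    diamond I J ≤ diamond I' J' :=
  bracket_mono ((ObjectProperty.monotone_extensionProduct_left _ h).trans
    (ObjectProperty.monotone_extensionProduct_right _ h'))

theorem step_le_succ (E : T) : ∀ n : ℕ, step E n ≤ step E (n + 1)
  | 0 => fun _ hX ↦ .zero hX
  | _ + 1 => fun _ hX ↦ .of_mem ⟨_, _, _, _, _, contractible_distinguished _, hX,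
      .zero (isZero_zero T)⟩

theorem step_mono (E : T) : Monotone (step E) := monotone_nat_of_le_succ (step_le_succ E)

theorem step_two_le {E E' : T} (h : bracket (ObjectProperty.singleton E') E) :
    step E 2 ≤ step E' 2 := by
  have : bracket (ObjectProperty.singleton E) ≤ bracket (ObjectProperty.singleton E') := by
    refine bracket_le fun X hX ↦ ?_
    rw [ObjectProperty.singleton_iff] at hX
    exact hX ▸ h
  exact diamond_mono this this

/-- Every `⟨E⟩_n` is contained in a full subcategory which contains `E` and is closed under the
operations that generate. -/
theorem step_le {E : T} {W : ObjectProperty T} (hE : W E) (hbracket : bracket W ≤ W)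
    (hext : ObjectProperty.extensionProduct W W ≤ W) : ∀ n : ℕ, step E n ≤ W
  | 0 => fun _ hX ↦ hbracket _ (.zero hX)
  | 1 => (bracket_mono fun X hX ↦ by
      rw [ObjectProperty.singleton_iff] at hX
      exact hX ▸ hE).trans hbracket
  | n + 2 => (bracket_mono ((ObjectProperty.monotone_extensionProduct_left _
      (step_le hE hbracket hext (n + 1))).trans
      ((ObjectProperty.monotone_extensionProduct_right _ (step_le hE hbracket hext 1)).trans
        hext))).trans hbracket

/-- A dichotomy that determines the dimension spectrum: no object generates in one step, and every
strong generator generates in two steps. -/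
theorem dimensionSpectrum_eq_singleton_one {O : T} (hO : step O 2 = ⊤)
    (h₁ : ∀ E : T, step E 1 ≠ ⊤) (h₂ : ∀ E : T, IsStrongGenerator E → step E 2 = ⊤) :
    dimensionSpectrum T = {1} := by
  ext d
  constructor
  · rintro ⟨n, rfl, E, h, h'⟩
    have hn : n < 2 := by
      by_contra! hn
      exact h' (top_le_iff.1 (h₂ E ⟨_, h⟩ ▸ step_mono E hn))
    have hn0 : n ≠ 0 := by
      rintro rfl
      exact h₁ E h
    obtain rfl : n = 1 := by lia
    rfl
  · rintro rfl
    exact ⟨1, rfl, O, hO, h₁ O⟩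

end TriangGen

/-! ### Bounded complexes over a hereditary abelian category -/

namespace CochainComplex

variable {C : Type*} [Category C] [Abelian C] (K : CochainComplex C ℤ) (n : ℤ)

/-- A morphism from a projective object to the homology of a complex lifts to the cycles. -/
theorem exists_single_hom_of_projective {P : C} [Projective P] (g : P ⟶ K.homology n) :
    ∃ f : (HomologicalComplex.single C (.up ℤ) n).obj P ⟶ K,
      HomologicalComplex.homologyMap f n =
        (HomologicalComplex.singleObjHomologySelfIso (.up ℤ) n P).hom ≫ g := by
  let t : P ⟶ K.cycles n := Projective.factorThru g (K.homologyπ n)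
  refine ⟨HomologicalComplex.mkHomFromSingle (t ≫ K.iCycles n) (by simp), ?_⟩
  rw [← cancel_epi (HomologicalComplex.homologyπ _ n), HomologicalComplex.homologyπ_naturality,
    HomologicalComplex.homologyπ_singleObjHomologySelfIso_hom_assoc,
    ← Projective.factorThru_comp g (K.homologyπ n), ← Category.assoc]
  congr 1
  rw [← cancel_mono (K.iCycles n), HomologicalComplex.cyclesMap_i,
    HomologicalComplex.mkHomFromSingle_f, HomologicalComplex.singleObjCyclesSelfIso_hom]
  simp [t]

theorem nonempty_homotopy_zero_of_comp_d_eq {P : C} (f : (singleFunctor C n).obj P ⟶ K)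
    (t : P ⟶ K.X (n - 1)) (ht : t ≫ K.d (n - 1) n =
      (HomologicalComplex.singleObjXSelf (.up ℤ) n P).inv ≫ f.f n) : Nonempty (Homotopy f 0) := by
  refine ⟨(HomComplex.Cochain.equivHomotopy f 0).symm
    ⟨HomComplex.Cochain.fromSingleMk t (by lia), ?_⟩⟩
  rw [HomComplex.Cochain.δ_fromSingleMk t _ 0 n (by lia), ht, HomComplex.Cochain.ofHom_zero,
    add_zero]
  apply (HomComplex.Cochain.fromSingleEquiv (add_zero n)).injective
  rw [HomComplex.Cochain.fromSingleEquiv_fromSingleMk]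
  simp [HomComplex.Cochain.fromSingleEquiv]

/-- A morphism to a complex from a projective object placed in a single degree is homotopic to zero
if it induces zero in homology. -/
theorem nonempty_homotopy_zero_of_homologyMap_eq_zero {P : C} [Projective P]
    (f : (HomologicalComplex.single C (.up ℤ) n).obj P ⟶ K)
    (hf : HomologicalComplex.homologyMap f n = 0) : Nonempty (Homotopy f 0) := by
  let c : P ⟶ K.cycles n := (HomologicalComplex.singleObjCyclesSelfIso (.up ℤ) n P).inv ≫
    HomologicalComplex.cyclesMap f n
  have hc : c ≫ K.homologyπ n = 0 := by
    rw [Category.assoc, ← HomologicalComplex.homologyπ_naturality, hf]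
    simp
  have hex : (ShortComplex.mk (K.toCycles (n - 1) n) (K.homologyπ n)
      (K.toCycles_comp_homologyπ _ _)).Exact :=
    ShortComplex.exact_of_g_is_cokernel _ (K.homologyIsCokernel (n - 1) n (by simp))
  let t : P ⟶ K.X (n - 1) := hex.liftFromProjective c hc
  have ht : t ≫ K.d (n - 1) n =
      (HomologicalComplex.singleObjXSelf (.up ℤ) n P).inv ≫ f.f n := by
    rw [← K.toCycles_i, ← Category.assoc]
    have : t ≫ K.toCycles (n - 1) n = c := hex.liftFromProjective_comp c hc
    rw [this]
    simp [c]
  exact nonempty_homotopy_zero_of_comp_d_eq K n f t ht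

end CochainComplex

namespace DerivedCategory

variable {C : Type*} [Category C] [Abelian C] [HasDerivedCategory C]

/-- If an object has a projective resolution `0 ⟶ S.X₁ ⟶ S.X₂ ⟶ S.X₃ ⟶ 0` of length one, an
isomorphism to the homology of a complex is induced by a morphism in the derived category: lift
`S.X₂ ⟶ S.X₃` to the cycles; the restriction of the lift to `S.X₁` is homotopic to zero. -/
theorem exists_single_hom_isIso_homology_Q {S : ShortComplex C} (hS : S.ShortExact)
    [Projective S.X₁] [Projective S.X₂] (K : CochainComplex C ℤ) (n : ℤ)
    (e : S.X₃ ≅ K.homology n) :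
    ∃ φ : (singleFunctor C n).obj S.X₃ ⟶ Q.obj K, IsIso ((homologyFunctor C n).map φ) := by
  obtain ⟨f, hf⟩ := CochainComplex.exists_single_hom_of_projective K n (S.g ≫ e.hom)
  let s := HomologicalComplex.single C (.up ℤ) n
  have nat {A B : C} (a : A ⟶ B) : HomologicalComplex.homologyMap (s.map a) n ≫
      (HomologicalComplex.singleObjHomologySelfIso (.up ℤ) n B).hom =
      (HomologicalComplex.singleObjHomologySelfIso (.up ℤ) n A).hom ≫ a :=
    (HomologicalComplex.homologyFunctorSingleIso C (.up ℤ) n).hom.naturality a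
  have h0 : HomologicalComplex.homologyMap (s.map S.f ≫ f) n = 0 := by
    rw [HomologicalComplex.homologyMap_comp, hf, ← Category.assoc, nat]
    simp
  obtain ⟨ho⟩ := CochainComplex.nonempty_homotopy_zero_of_homologyMap_eq_zero K n _ h0
  have hz : Q.map (s.map S.f) ≫ Q.map f = 0 := by
    rw [← Functor.map_comp, Q_map_eq_of_homotopy C ho, Functor.map_zero]
  have hs := hS.map_of_exact s
  obtain ⟨φ, hφ⟩ : ∃ φ : Q.obj (s.obj S.X₃) ⟶ Q.obj K, Q.map f = Q.map (s.map S.g) ≫ φ :=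
    Pretriangulated.Triangle.yoneda_exact₂ _ (triangleOfSES_distinguished hs) (Q.map f) hz
  have h1 := congrArg (homologyFunctor C n).map hφ
  rw [Functor.map_comp] at h1
  let η := homologyFunctorFactors C n
  let a (A : C) : (homologyFunctor C n).obj (Q.obj (s.obj A)) ≅ A :=
    η.app (s.obj A) ≪≫ HomologicalComplex.singleObjHomologySelfIso (.up ℤ) n A
  let b : (homologyFunctor C n).obj (Q.obj K) ≅ K.homology n := η.app K
  have m1 : (homologyFunctor C n).map (Q.map f) ≫ b.hom = (a S.X₂).hom ≫ S.g ≫ e.hom :=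
    (η.hom.naturality f).trans ((congrArg (η.hom.app (s.obj S.X₂) ≫ ·) hf).trans
      (Category.assoc _ _ _).symm)
  have m2 : (homologyFunctor C n).map (Q.map (s.map S.g)) ≫ (a S.X₃).hom = (a S.X₂).hom ≫ S.g :=
    ((η.hom.naturality_assoc (s.map S.g) _).trans
      (congrArg (η.hom.app (s.obj S.X₂) ≫ ·) (nat S.g))).trans (Category.assoc _ _ _).symm
  have : Epi S.g := hS.epi_g
  have : Epi ((homologyFunctor C n).map (Q.map (s.map S.g))) := by
    rw [← Iso.eq_comp_inv] at m2
    rw [m2]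
    infer_instance
  have key : (homologyFunctor C n).map φ ≫ b.hom = (a S.X₃).hom ≫ e.hom := by
    rw [← cancel_epi ((homologyFunctor C n).map (Q.map (s.map S.g))), reassoc_of% m2, ← m1, h1,
      Category.assoc]
  have : IsIso ((homologyFunctor C n).map φ) := by
    rw [← Iso.eq_comp_inv] at key
    rw [key]
    infer_instance
  exact ⟨φ, this⟩

/-- If the homology of `X` in degree `n` has a projective resolution of length one, then, placed in
degree `n`, it maps to `X` by a morphism which is an isomorphism on homology in that degree. -/
theorem exists_single_hom_isIso_homology {S : ShortComplex C} (hS : S.ShortExact)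
    [Projective S.X₁] [Projective S.X₂] (X : DerivedCategory C) (n : ℤ)
    (e : S.X₃ ≅ (homologyFunctor C n).obj X) :
    ∃ φ : (singleFunctor C n).obj ((homologyFunctor C n).obj X) ⟶ X,
      IsIso ((homologyFunctor C n).map φ) := by
  let i := Q.objObjPreimageIso X
  obtain ⟨φ, hφ⟩ := exists_single_hom_isIso_homology_Q hS (Q.objPreimage X) n
    (e ≪≫ (homologyFunctor C n).mapIso i.symm ≪≫ (homologyFunctorFactors C n).app _)
  refine ⟨(singleFunctor C n).map e.inv ≫ φ ≫ i.hom, ?_⟩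
  simp only [Functor.map_comp]
  infer_instance

theorem isZero_homology_singleFunctor (M : C) {i n : ℤ} (h : i ≠ n) :
    IsZero ((homologyFunctor C i).obj ((singleFunctor C n).obj M)) := by
  rcases h.lt_or_gt with h | h
  · exact isZero_of_isGE _ n i h
  · exact isZero_of_isLE _ n i h

namespace Bounded

variable (C) in
/-- The functor to the bounded derived category that places an object in degree `n`. -/
noncomputable def singleFunctor (n : ℤ) : C ⥤ Bounded C :=
  ObjectProperty.lift _ (DerivedCategory.singleFunctor C n)
    fun _ ↦ ⟨⟨n, inferInstance⟩, ⟨n, inferInstance⟩⟩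

instance (n : ℤ) : (singleFunctor C n).Additive where
  map_add {_ _ f g} :=
    ObjectProperty.hom_ext _ ((DerivedCategory.singleFunctor C n).map_add (f := f) (g := g))

variable (C) in
/-- The homology functors on the bounded derived category. -/
noncomputable def homologyFunctor (n : ℤ) : Bounded C ⥤ C :=
  Bounded.ι ⋙ DerivedCategory.homologyFunctor C n

instance (n : ℤ) : (homologyFunctor C n).Additive := by
  unfold homologyFunctor; infer_instance

/-- Shifting an object placed in degree `n` by `n` moves it to degree `0`. -/
noncomputable def shiftSingleIso (n : ℤ) (M : C) :
    ((singleFunctor C n).obj M)⟦n⟧ ≅ (singleFunctor C 0).obj M :=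
  ObjectProperty.isoMk _ ((Bounded.ι.commShiftIso n).app _ ≪≫
    ((singleFunctors C).shiftIso n 0 n (add_zero n)).app M)

/-- The homology of a shift. -/
noncomputable def homologyShiftIso (n i : ℤ) (X : Bounded C) :
    (homologyFunctor C i).obj (X⟦n⟧) ≅ (homologyFunctor C (n + i)).obj X :=
  (DerivedCategory.homologyFunctor C i).mapIso ((Bounded.ι.commShiftIso n).app X) ≪≫
    ((DerivedCategory.homologyFunctor C 0).shiftIso n i (n + i) rfl).app X.obj

/-- The homology of an object placed in degree `n`. -/
noncomputable def homologySingleIso (n : ℤ) (M : C) :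
    (homologyFunctor C n).obj ((singleFunctor C n).obj M) ≅ M :=
  (singleFunctorCompHomologyFunctorIso C n).app M

theorem homology_exact₂ (T : Pretriangulated.Triangle (Bounded C))
    (hT : T ∈ Pretriangulated.distinguishedTriangles) (n : ℤ) :
    (ShortComplex.mk ((homologyFunctor C n).map T.mor₁) ((homologyFunctor C n).map T.mor₂) (by
      rw [← Functor.map_comp, Pretriangulated.comp_distTriang_mor_zero₁₂ _ hT,
        Functor.map_zero])).Exact :=
  HomologySequence.exact₂ _ (Bounded.ι.map_distinguished T hT) n

theorem isIso_of_isIso_homology {X Y : Bounded C} (f : X ⟶ Y)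
    (h : ∀ n, IsIso ((homologyFunctor C n).map f)) : IsIso f := by
  have : IsIso (Bounded.ι.map f) := (DerivedCategory.isIso_iff _ _).2 h
  exact isIso_of_fully_faithful Bounded.ι f

theorem exists_finset_isZero_homology (X : Bounded C) :
    ∃ s : Finset ℤ, ∀ i ∉ s, IsZero ((homologyFunctor C i).obj X) := by
  obtain ⟨⟨a, ha⟩, ⟨b, hb⟩⟩ := X.property
  refine ⟨Finset.Icc a b, fun i hi ↦ ?_⟩
  rw [Finset.mem_Icc, not_and_or, not_le, not_le] at hi
  rcases hi with hi | hi
  · exact isZero_of_isGE X.obj a i hi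
  · exact isZero_of_isLE X.obj b i hi

/-- Over a hereditary abelian category with enough projectives, a bounded complex is the direct sum
of its homology objects, placed in their degrees. -/
theorem exists_decomposition (hC : ∀ M : C, ∃ S : ShortComplex C, S.ShortExact ∧
      Projective S.X₁ ∧ Projective S.X₂ ∧ Nonempty (S.X₃ ≅ M)) (X : Bounded C) :
    ∃ (s : Finset ℤ) (φ : ∀ i, (singleFunctor C i).obj ((homologyFunctor C i).obj X) ⟶ X)
      (ψ : ∀ i, X ⟶ (singleFunctor C i).obj ((homologyFunctor C i).obj X)),
      (∀ i, φ i ≫ ψ i = 𝟙 _) ∧ ∑ i ∈ s, ψ i ≫ φ i = 𝟙 X := by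
  classical
  obtain ⟨s, hs⟩ := exists_finset_isZero_homology X
  have (i : ℤ) : ∃ φ : (singleFunctor C i).obj ((homologyFunctor C i).obj X) ⟶ X,
      IsIso ((homologyFunctor C i).map φ) := by
    obtain ⟨S, hS, _, _, ⟨e⟩⟩ := hC ((homologyFunctor C i).obj X)
    obtain ⟨φ, hφ⟩ := exists_single_hom_isIso_homology hS X.obj i e
    exact ⟨ObjectProperty.homMk φ, hφ⟩
  choose φ hφ using this
  let Y (i : s) : Bounded C := (singleFunctor C i).obj ((homologyFunctor C i).obj X)
  let Φ : ⨁ Y ⟶ X := biproduct.desc fun i ↦ φ i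
  have zero {i : ℤ} {j : s} (h : i ≠ j) : IsZero ((homologyFunctor C i).obj (Y j)) :=
    isZero_homology_singleFunctor _ h
  have hid (i : ℤ) : 𝟙 ((homologyFunctor C i).obj (⨁ Y)) = ∑ j : s,
      (homologyFunctor C i).map (biproduct.π Y j) ≫ (homologyFunctor C i).map (biproduct.ι Y j) := by
    simp only [← Functor.map_comp, ← Functor.map_sum, biproduct.total, CategoryTheory.Functor.map_id]
  -- In each degree only the summand with that index has homology.
  have : IsIso Φ := by
    refine isIso_of_isIso_homology _ fun i ↦ ?_
    by_cases hi : i ∈ s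
    · have : IsIso ((homologyFunctor C i).map (biproduct.ι Y ⟨i, hi⟩)) := by
        refine ⟨(homologyFunctor C i).map (biproduct.π Y ⟨i, hi⟩), ?_, ?_⟩
        · rw [← Functor.map_comp, biproduct.ι_π_self, CategoryTheory.Functor.map_id]
        · rw [hid, Finset.sum_eq_single ⟨i, hi⟩ _ (by simp)]
          intro j _ hj
          rw [(zero fun h ↦ hj (Subtype.ext h.symm)).eq_zero_of_tgt
            ((homologyFunctor C i).map (biproduct.π Y j)), zero_comp]
      have h : (homologyFunctor C i).map (biproduct.ι Y ⟨i, hi⟩) ≫ (homologyFunctor C i).map Φ =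
          (homologyFunctor C i).map (φ i) := by
        rw [← Functor.map_comp, biproduct.ι_desc]
      have := hφ i
      rw [← h] at this
      exact IsIso.of_isIso_comp_left ((homologyFunctor C i).map (biproduct.ι Y ⟨i, hi⟩)) _
    · refine isIso_of_source_target_iso_zero _ (IsZero.isoZero ?_) (hs i hi).isoZero
      rw [IsZero.iff_id_eq_zero, hid]
      refine Finset.sum_eq_zero fun j _ ↦ ?_
      have hij : i ≠ j := fun h ↦ hi (h ▸ j.2)
      rw [(zero hij).eq_zero_of_tgt ((homologyFunctor C i).map (biproduct.π Y j)), zero_comp]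
  refine ⟨s, φ, fun i ↦ if hi : i ∈ s then inv Φ ≫ biproduct.π Y ⟨i, hi⟩ else 0, fun i ↦ ?_, ?_⟩
  · by_cases hi : i ∈ s
    · have : biproduct.ι Y ⟨i, hi⟩ ≫ Φ = φ i := biproduct.ι_desc _ _
      simp only [hi, dite_true, ← this]
      rw [Category.assoc, IsIso.hom_inv_id_assoc, biproduct.ι_π_self]
    · exact ((singleFunctor C i).map_isZero (hs i hi)).eq_of_src _ _
  · rw [← Finset.sum_coe_sort s]
    have : ∑ j : s, inv Φ ≫ (biproduct.π Y j ≫ biproduct.ι Y j) ≫ Φ = 𝟙 X := by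
      rw [← Preadditive.comp_sum, ← Preadditive.sum_comp, biproduct.total]
      simp
    rw [← this]
    refine Finset.sum_congr rfl fun j _ ↦ ?_
    have : biproduct.ι Y j ≫ Φ = φ j := biproduct.ι_desc _ _
    simp [← this, Y]

end Bounded

end DerivedCategory

/-! ### Generation in the bounded derived category of a hereditary abelian category -/

namespace DerivedCategory.Bounded

open Pretriangulated TriangGen

variable {C : Type*} [Category C] [Abelian C] [HasDerivedCategory C]

/-- An object placed in degree `n` is the cone of a resolution of length one, placed in the same
degree. -/
theorem exists_distinguished_of_shortExact {S : ShortComplex C} (hS : S.ShortExact) (n : ℤ) :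
    ∃ (Z : Bounded C) (b : (singleFunctor C n).obj S.X₂ ⟶ Z)
      (c : Z ⟶ ((singleFunctor C n).obj S.X₁)⟦(1 : ℤ)⟧),
      Triangle.mk ((singleFunctor C n).map S.f) b c ∈ distinguishedTriangles ∧
        Nonempty (Z ≅ (singleFunctor C n).obj S.X₃) := by
  obtain ⟨Z, b, c, h⟩ := distinguished_cocone_triangle ((singleFunctor C n).map S.f)
  refine ⟨Z, b, c, h, ⟨ObjectProperty.isoMk _ ?_⟩⟩
  let e := isoTriangleOfIso₁₂ _ _ (Bounded.ι.map_distinguished _ h)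
    (triangleOfSES_distinguished (hS.map_of_exact (HomologicalComplex.single C (.up ℤ) n)))
    (Iso.refl _) (Iso.refl _) ((Category.comp_id _).trans (Category.id_comp _).symm)
  exact Triangle.π₃.mapIso e

theorem bracket_single {I : ObjectProperty (Bounded C)} {M P : C} (h : IsSummandOfPower M P)
    {m : ℤ} (hM : bracket I ((singleFunctor C m).obj M)) (n : ℤ) :
    bracket I ((singleFunctor C n).obj P) := by
  have h₀ : bracket I ((singleFunctor C 0).obj M) := bracket_of_iso (shiftSingleIso m M) (hM.shift m)
  refine bracket_of_shift n (bracket_of_iso (shiftSingleIso n P).symm ?_)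
  exact bracket_of_isSummandOfPower (h.map (singleFunctor C 0)) h₀

/-- If every object has a resolution of length one by summands of finite powers of a projective
object `O`, then `O` generates the bounded derived category in two steps. -/
theorem step_two_eq_top (O : C) [Projective O] (hC : ∀ M : C, ∃ S : ShortComplex C, S.ShortExact ∧
      IsSummandOfPower O S.X₁ ∧ IsSummandOfPower O S.X₂ ∧ Nonempty (S.X₃ ≅ M)) :
    step ((singleFunctor C 0).obj O) 2 = ⊤ := by
  have hO : bracket (ObjectProperty.singleton ((singleFunctor C 0).obj O))
      ((singleFunctor C 0).obj O) := .of_mem (by simp)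
  have hsingle (M : C) (n : ℤ) :
      step ((singleFunctor C 0).obj O) 2 ((singleFunctor C n).obj M) := by
    obtain ⟨S, hS, h₁, h₂, ⟨e⟩⟩ := hC M
    obtain ⟨Z, b, c, h, ⟨e'⟩⟩ := exists_distinguished_of_shortExact hS n
    refine bracket_of_iso (e' ≪≫ (singleFunctor C n).mapIso e) (.of_mem ?_)
    -- The rotated triangle is `S.X₂ ⟶ S.X₃ ⟶ S.X₁⟦1⟧ ⟶ S.X₂⟦1⟧`.
    exact ⟨_, _, _, _, _, rot_of_distTriang _ h, bracket_single h₂ hO n,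
      (bracket_single h₁ hO n).shift 1⟩
  refine top_le_iff.1 fun X _ ↦ ?_
  obtain ⟨s, φ, ψ, -, h⟩ := exists_decomposition (fun M ↦ by
    obtain ⟨S, hS, h₁, h₂, e⟩ := hC M
    exact ⟨S, hS, h₁.projective, h₂.projective, e⟩) X
  exact bracket_of_sum_eq_id s (fun i _ ↦ hsingle _ i) ψ φ h

/-- Over a hereditary abelian category with enough projectives, `⟨E⟩` contains the summands of
finite powers of the homology objects of `E`. -/
theorem bracket_single_of_homology (hC : ∀ M : C, ∃ S : ShortComplex C, S.ShortExact ∧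
      Projective S.X₁ ∧ Projective S.X₂ ∧ Nonempty (S.X₃ ≅ M)) {E : Bounded C} {i : ℤ} {P : C}
    (h : IsSummandOfPower ((homologyFunctor C i).obj E) P) (n : ℤ) :
    bracket (ObjectProperty.singleton E) ((singleFunctor C n).obj P) := by
  obtain ⟨s, φ, ψ, h', -⟩ := exists_decomposition hC E
  exact bracket_single h (.summand ⟨φ i, ψ i, h' i⟩ (.of_mem (by simp))) n

/-- The objects whose homology objects all satisfy a property of objects of the abelian category. -/
def homologyProp (p : ObjectProperty C) : ObjectProperty (Bounded C) :=
  fun X ↦ ∀ i, p ((homologyFunctor C i).obj X)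

theorem bracket_homologyProp_le {p : ObjectProperty C} (hzero : ∀ M, IsZero M → p M)
    (hsum : ∀ M N, p M → p N → p (M ⊞ N)) (hretract : ∀ {M N}, Retract M N → p N → p M) :
    bracket (homologyProp p) ≤ homologyProp p := by
  intro X hX
  induction hX with
  | of_mem hX => exact hX
  | zero hX => exact fun i ↦ hzero _ ((homologyFunctor C i).map_isZero hX)
  | sum _ _ h₁ h₂ =>
    intro i
    have := preservesBinaryBiproducts_of_preservesBiproducts (homologyFunctor C i)
    exact hretract ((homologyFunctor C i).mapBiprod _ _).retract (hsum _ _ (h₁ i) (h₂ i))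
  | summand r _ h => exact fun i ↦ hretract (r.map (homologyFunctor C i)) (h i)
  | shift n _ h => exact fun i ↦ hretract (homologyShiftIso n i _).retract (h (n + i))

theorem extensionProduct_homologyProp_le {p : ObjectProperty C}
    (hext : ∀ S : ShortComplex C, S.Exact → p S.X₁ → p S.X₃ → p S.X₂) :
    ObjectProperty.extensionProduct (homologyProp p) (homologyProp p) ≤ homologyProp p := by
  rintro X ⟨Y, Z, f, g, h, hT, hY, hZ⟩ i
  exact hext _ (homology_exact₂ _ hT i) (hY i) (hZ i)

end DerivedCategory.Bounded

/-! ### Finitely generated modules over a Dedekind domain -/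

namespace Module

variable {A : Type*} [CommRing A] {M : Type*} [AddCommGroup M] [Module A M]

theorem projective_of_isDedekindDomain [IsDedekindDomain A] [Module.Finite A M]
    [Module.IsTorsionFree A M] : Module.Projective A M :=
  have : Module.FinitePresentation A M := Module.finitePresentation_of_finite A M
  Module.Flat.projective_of_finitePresentation

/-- The trace ideal of a nonzero finitely generated projective module over a domain is the unit
ideal. -/
theorem one_mem_span_range_apply [IsDomain A] [Module.Finite A M] [Module.Projective A M]
    [Nontrivial M] :
    (1 : A) ∈ Ideal.span (Set.range fun p : (M →ₗ[A] A) × M ↦ p.1 p.2) := by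
  set I := Ideal.span (Set.range fun p : (M →ₗ[A] A) × M ↦ p.1 p.2)
  obtain ⟨n, f, g, -, -, hfg⟩ := Module.Finite.exists_comp_eq_id_of_projective A M
  -- The dual basis lemma gives `M = I • M`, so that Nakayama's lemma applies.
  have hI : (⊤ : Submodule A M) ≤ I • ⊤ := by
    intro x _
    have hx : f (g x) = x := congr($hfg x)
    rw [← hx, LinearMap.pi_apply_eq_sum_univ f (g x)]
    refine Submodule.sum_mem _ fun j _ ↦ Submodule.smul_mem_smul ?_ trivial
    exact Ideal.subset_span ⟨(LinearMap.proj j ∘ₗ g, x), rfl⟩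
  obtain ⟨r, hr, hr'⟩ := Submodule.exists_sub_one_mem_and_smul_eq_zero_of_fg_of_le_smul I ⊤
    Module.Finite.fg_top hI
  obtain ⟨x, hx⟩ := exists_ne (0 : M)
  obtain rfl : r = 0 := (smul_eq_zero.1 (hr' x trivial)).resolve_right hx
  simpa using hr

/-- Over a Dedekind domain `A`, a finitely generated module that is not torsion has `A` as a direct
summand of some finite power. -/
theorem exists_sum_apply_eq_one [IsDedekindDomain A] [Module.Finite A M]
    (hM : ¬ Module.IsTorsion A M) :
    ∃ (n : ℕ) (x : Fin n → M) (φ : Fin n → (M →ₗ[A] A)), ∑ j, φ j (x j) = 1 := by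
  -- The quotient of `M` by its torsion is a nonzero projective module. The elements `x j` lift those
  -- at which functionals on the quotient take values that combine to `1`.
  have : Nontrivial (M ⧸ Submodule.torsion A M) := by
    rw [Submodule.Quotient.nontrivial_iff]
    intro h
    refine hM fun x ↦ ?_
    have : x ∈ Submodule.torsion A M := h ▸ trivial
    exact this
  have : Module.IsTorsionFree A (M ⧸ Submodule.torsion A M) :=
    Submodule.isTorsionFree_iff_torsion_eq_bot.2 Submodule.QuotientTorsion.torsion_eq_bot
  have : Module.Projective A (M ⧸ Submodule.torsion A M) := projective_of_isDedekindDomain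
  obtain ⟨n, c, p, h⟩ := Submodule.mem_span_set'.1
    (one_mem_span_range_apply (A := A) (M := M ⧸ Submodule.torsion A M))
  choose q hq using fun j ↦ (p j).2
  choose x hx using fun j ↦ Submodule.Quotient.mk_surjective _ (q j).2
  refine ⟨n, x, fun j ↦ c j • (q j).1 ∘ₗ Submodule.mkQ _, ?_⟩
  rw [← h]
  refine Finset.sum_congr rfl fun j _ ↦ ?_
  simp only [← hq, ← hx]
  rfl

end Module

namespace ModuleCat

variable {A : Type u} [CommRing A]

theorem isSummandOfPower_of_projective (N : ModuleCat.{u} A) [Module.Finite A N]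
    [Module.Projective A N] : IsSummandOfPower (ModuleCat.of A A) N := by
  obtain ⟨n, f, g, -, -, hfg⟩ := Module.Finite.exists_comp_eq_id_of_projective A N
  refine ⟨n, fun j ↦ ModuleCat.ofHom (LinearMap.proj j ∘ₗ g),
    fun j ↦ ModuleCat.ofHom (f ∘ₗ LinearMap.single A (fun _ ↦ A) j), ?_⟩
  ext x
  simp only [ModuleCat.hom_sum, ModuleCat.hom_comp, ModuleCat.hom_ofHom, LinearMap.sum_apply,
    LinearMap.comp_apply, ← map_sum, LinearMap.proj_apply, LinearMap.coe_single,
    Finset.univ_sum_single]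
  exact congr($hfg x)

theorem isSummandOfPower_of_not_isTorsion [IsDedekindDomain A] (M : ModuleCat.{u} A)
    [Module.Finite A M] (hM : ¬ Module.IsTorsion A M) :
    IsSummandOfPower M (ModuleCat.of A A) := by
  obtain ⟨n, x, φ, h⟩ := Module.exists_sum_apply_eq_one hM
  refine ⟨n, fun j ↦ ModuleCat.ofHom (LinearMap.toSpanSingleton A M (x j)),
    fun j ↦ ModuleCat.ofHom (φ j), ?_⟩
  ext
  simpa [ModuleCat.hom_sum] using h

end ModuleCat

/-! ### Abelian categories of finitely generated modules over a Dedekind domain -/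

namespace DedekindGen

variable {C : Type*} [Category C] {A : Type u} [CommRing A] (F : C ⥤ ModuleCat.{u} A)

/-- The objects whose underlying module is torsion. -/
def torsionProp : ObjectProperty C := fun M ↦ Module.IsTorsion A (F.obj M)

/-- The objects such that `a` annihilates the torsion of the underlying module. -/
def killsTorsionProp (a : A) : ObjectProperty C :=
  fun M ↦ ∀ x : F.obj M, x ∈ Submodule.torsion A (F.obj M) → a • x = 0

variable {F}

theorem map_retract_apply {M N : C} (r : Retract M N) (x : F.obj M) :
    F.map r.r (F.map r.i x) = x := by
  rw [← ConcreteCategory.comp_apply, ← F.map_comp, r.retract, F.map_id]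
  rfl

theorem map_mem_torsion {M N : C} (f : M ⟶ N) {x : F.obj M}
    (hx : x ∈ Submodule.torsion A (F.obj M)) :
    F.map f x ∈ Submodule.torsion A (F.obj N) := by
  obtain ⟨a, ha⟩ := hx
  refine ⟨a, ?_⟩
  have : a.1 • F.map f x = F.map f (a.1 • x) := ((F.map f).hom.map_smul _ _).symm
  exact this.trans ((congrArg _ ha).trans (map_zero (F.map f).hom))

theorem torsionProp_of_retract {M N : C} (r : Retract M N) (h : torsionProp F N) :
    torsionProp F M := by
  intro x
  have : F.map r.r (F.map r.i x) ∈ Submodule.torsion A (F.obj M) :=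
    map_mem_torsion r.r (h (x := F.map r.i x))
  rwa [map_retract_apply] at this

theorem killsTorsionProp_of_retract {a : A} {M N : C} (r : Retract M N)
    (h : killsTorsionProp F a N) : killsTorsionProp F a M := by
  intro x hx
  rw [← map_retract_apply r x]
  have := h _ (map_mem_torsion r.i hx)
  exact ((F.map r.r).hom.map_smul _ _).symm.trans
    ((congrArg _ this).trans (map_zero (F.map r.r).hom))

/-- The torsion of a finitely generated module is annihilated by a single nonzero element. -/
theorem exists_killsTorsionProp [IsDomain A] [IsNoetherianRing A] (M : C)
    [Module.Finite A (F.obj M)] : ∃ a : A, a ≠ 0 ∧ killsTorsionProp F a M := by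
  obtain ⟨a, ha⟩ := Submodule.annihilator_top_inter_nonZeroDivisors
    (Submodule.torsion_isTorsion (R := A) (M := F.obj M))
  refine ⟨a, nonZeroDivisors.ne_zero ha.2, fun x hx ↦ ?_⟩
  have := Submodule.mem_annihilator.1 ha.1 ⟨x, hx⟩ trivial
  exact congrArg Subtype.val this

variable [Abelian C] [F.Additive]

theorem map_biprod_total_apply (M N : C) (x : ↑(F.obj (M ⊞ N))) :
    F.map biprod.inl (F.map (biprod.fst : M ⊞ N ⟶ M) x) +
      F.map biprod.inr (F.map (biprod.snd : M ⊞ N ⟶ N) x) = x := by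
  have h := congrArg (fun f ↦ (F.map f).hom x) (biprod.total (X := M) (Y := N))
  simp only [F.map_add, F.map_comp, F.map_id, ModuleCat.hom_add, ModuleCat.hom_comp,
    LinearMap.add_apply, LinearMap.comp_apply, ModuleCat.hom_id, LinearMap.id_apply] at h
  exact h

theorem torsionProp_of_exact [PreservesFiniteLimits F] [PreservesFiniteColimits F]
    (S : ShortComplex C) (hS : S.Exact) (h₁ : torsionProp F S.X₁) (h₃ : torsionProp F S.X₃) :
    torsionProp F S.X₂ := by
  intro x
  have hex := (ShortComplex.moduleCat_exact_iff _).1 (hS.map F)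
  obtain ⟨a, ha⟩ := h₃ (x := F.map S.g x)
  obtain ⟨y, hy⟩ := hex (a.1 • x) (((F.map S.g).hom.map_smul _ _).trans ha)
  obtain ⟨b, hb⟩ := h₁ (x := y)
  refine ⟨b * a, ?_⟩
  have h1 : (b * a) • x = b.1 • (a.1 • x) := mul_smul b.1 a.1 x
  have h2 : F.map S.f y = a.1 • x := hy
  rw [h1, ← h2]
  exact ((F.map S.f).hom.map_smul _ _).symm.trans ((congrArg _ hb).trans (map_zero (F.map S.f).hom))

theorem torsionProp_biprod (M N : C) (hM : torsionProp F M) (hN : torsionProp F N) :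
    torsionProp F (M ⊞ N) := by
  intro x
  have : F.map biprod.inl (F.map (biprod.fst : M ⊞ N ⟶ M) x) +
      F.map biprod.inr (F.map (biprod.snd : M ⊞ N ⟶ N) x) ∈ Submodule.torsion A (F.obj (M ⊞ N)) :=
    add_mem (map_mem_torsion _ (hM (x := _))) (map_mem_torsion _ (hN (x := _)))
  rwa [map_biprod_total_apply] at this

theorem torsionProp_of_isZero {M : C} (hM : IsZero M) : torsionProp F M := by
  intro x
  have := ModuleCat.subsingleton_of_isZero (F.map_isZero hM)
  exact ⟨1, Subsingleton.elim _ _⟩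

theorem killsTorsionProp_biprod {a : A} (M N : C) (hM : killsTorsionProp F a M)
    (hN : killsTorsionProp F a N) : killsTorsionProp F a (M ⊞ N) := by
  intro x hx
  rw [← map_biprod_total_apply M N x, smul_add]
  have h1 := hM _ (map_mem_torsion biprod.fst hx)
  have h2 := hN _ (map_mem_torsion biprod.snd hx)
  have e1 := ((F.map (biprod.inl : M ⟶ M ⊞ N)).hom.map_smul a _).symm.trans
    ((congrArg _ h1).trans (map_zero (F.map (biprod.inl : M ⟶ M ⊞ N)).hom))
  have e2 := ((F.map (biprod.inr : N ⟶ M ⊞ N)).hom.map_smul a _).symm.trans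
    ((congrArg _ h2).trans (map_zero (F.map (biprod.inr : N ⟶ M ⊞ N)).hom))
  exact (congrArg₂ (· + ·) e1 e2).trans (add_zero _)

theorem killsTorsionProp_of_isZero {a : A} {M : C} (hM : IsZero M) :
    killsTorsionProp F a M := by
  intro x _
  have := ModuleCat.subsingleton_of_isZero (F.map_isZero hM)
  exact Subsingleton.elim _ _

end DedekindGen

/-! ### Generation time over a Dedekind domain -/

namespace DedekindGen

open TriangGen DerivedCategory.Bounded
open DerivedCategory (Bounded)

variable {C : Type*} [Category C] [Abelian C] {A : Type u} [CommRing A]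
  {F : C ⥤ ModuleCat.{u} A} [F.Additive]

theorem isSummandOfPower_of_projective [F.Full] [F.Faithful] {O P : C}
    (e : F.obj O ≅ ModuleCat.of A A) [Module.Finite A (F.obj P)]
    [Module.Projective A (F.obj P)] : IsSummandOfPower O P :=
  .of_map F ((ModuleCat.isSummandOfPower_of_projective (F.obj P)).of_iso e.symm (Iso.refl _))

/-- No object `E` generates in one step: a single nonzero element `b` annihilates the torsion of the
homology of every object of `⟨E⟩`, but not the module `A ⧸ (b t)` for a nonzero nonunit `t`. -/
theorem step_one_ne_top [IsDedekindDomain A] [HasDerivedCategory C] (hA : ¬ IsField A)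
    (hfin : ∀ M, Module.Finite A (F.obj M))
    (hess : ∀ N : ModuleCat.{u} A, Module.Finite A N → ∃ M, Nonempty (F.obj M ≅ N))
    (E : Bounded C) : step E 1 ≠ ⊤ := by
  intro htop
  obtain ⟨s, hs⟩ := exists_finset_isZero_homology E
  choose a ha₀ ha using fun i ↦ exists_killsTorsionProp (F := F) ((homologyFunctor C i).obj E)
  set b := ∏ i ∈ s, a i
  have hb₀ : b ≠ 0 := Finset.prod_ne_zero_iff.2 fun i _ ↦ ha₀ i
  have hE : homologyProp (killsTorsionProp F b) E := by
    intro i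
    by_cases hi : i ∈ s
    · intro x hx
      obtain ⟨c, hc⟩ := Finset.dvd_prod_of_mem a hi
      rw [show b = c * a i from hc.trans (mul_comm _ _), mul_smul, ha i x hx, smul_zero]
    · exact killsTorsionProp_of_isZero (hs i hi)
  obtain ⟨t, ht₀, ht⟩ := Ring.exists_not_isUnit_of_not_isField hA
  obtain ⟨M, ⟨φ⟩⟩ := hess (.of A (A ⧸ Ideal.span {b * t}))
    (inferInstanceAs (Module.Finite A (A ⧸ Ideal.span {b * t})))
  have hle : step E 1 ≤ homologyProp (killsTorsionProp F b) :=
    (bracket_mono fun X hX ↦ by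
      obtain rfl : E = X := by simpa using hX
      exact hE).trans
    (bracket_homologyProp_le (fun _ ↦ killsTorsionProp_of_isZero) killsTorsionProp_biprod
      killsTorsionProp_of_retract)
  rw [htop] at hle
  have hM := hle ((singleFunctor C 0).obj M) trivial 0
  let ψ := (F.mapIso (homologySingleIso 0 M) ≪≫ φ).toLinearEquiv
  have hmem (r : A) : r • ψ.symm (Ideal.Quotient.mk _ 1) = 0 ↔ b * t ∣ r := by
    rw [← map_smul, LinearEquiv.map_eq_zero_iff, ← Ideal.mem_span_singleton,
      ← Ideal.Quotient.eq_zero_iff_mem]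
    change Ideal.Quotient.mk _ (r * 1) = 0 ↔ _
    rw [mul_one]
  have hbt := (hmem b).1 (hM _ ⟨⟨b * t, mem_nonZeroDivisors_of_ne_zero (mul_ne_zero hb₀ ht₀)⟩,
    (hmem _).2 dvd_rfl⟩)
  exact ht (isUnit_of_dvd_one ((mul_dvd_mul_iff_left hb₀).1 (by rwa [mul_one])))

variable [PreservesFiniteLimits F] [PreservesFiniteColimits F]

theorem projective_of_iso [F.Full] [F.Faithful] {O : C} (e : F.obj O ≅ ModuleCat.of A A) :
    Projective O := by
  have : Projective (F.obj O) := Projective.of_iso e.symm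
    ((ModuleCat.of A A).projective_of_categoryTheory_projective)
  exact F.projective_of_map_projective this

variable [IsDedekindDomain A]

/-- A strong generator has a homology object that is not torsion: otherwise all objects of the
bounded derived category would have torsion homology. -/
theorem exists_not_isTorsion_homology [HasDerivedCategory C] {O : C}
    (e : F.obj O ≅ ModuleCat.of A A) {E : Bounded C}
    (hE : IsStrongGenerator E) :
    ∃ i, ¬ Module.IsTorsion A (F.obj ((homologyFunctor C i).obj E)) := by
  by_contra! h
  obtain ⟨n, hn⟩ := hE
  have hle := step_le (E := E) (W := homologyProp (torsionProp F)) h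
    (bracket_homologyProp_le (fun _ ↦ torsionProp_of_isZero) torsionProp_biprod
      torsionProp_of_retract)
    (extensionProduct_homologyProp_le torsionProp_of_exact) n
  rw [hn] at hle
  have hO := hle ((singleFunctor C 0).obj O) trivial 0
  let ψ := (F.mapIso (homologySingleIso 0 O) ≪≫ e).toLinearEquiv
  obtain ⟨a, ha⟩ := hO (x := ψ.symm (1 : A))
  have h : a.1 • ψ.symm (1 : A) = 0 := ha
  rw [← map_smul, LinearEquiv.map_eq_zero_iff] at h
  have h : a.1 * 1 = 0 := h
  exact nonZeroDivisors.ne_zero a.2 ((mul_one _).symm.trans h)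

variable [F.Full] [F.Faithful]

/-- Over a Dedekind domain a submodule of a finite free module is projective, so every object has a
resolution of length one by summands of finite powers of the object corresponding to the ring. -/
theorem exists_resolution (hfin : ∀ M, Module.Finite A (F.obj M))
    (hess : ∀ N : ModuleCat.{u} A, Module.Finite A N → ∃ M, Nonempty (F.obj M ≅ N))
    {O : C} (e : F.obj O ≅ ModuleCat.of A A) (M : C) :
    ∃ S : ShortComplex C, S.ShortExact ∧ IsSummandOfPower O S.X₁ ∧ IsSummandOfPower O S.X₂ ∧
      Nonempty (S.X₃ ≅ M) := by
  have := hfin M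
  obtain ⟨n, f, hf⟩ := Module.Finite.exists_fin' A (F.obj M)
  obtain ⟨P, ⟨eP⟩⟩ := hess (.of A (Fin n → A)) (inferInstanceAs (Module.Finite A (Fin n → A)))
  let p : P ⟶ M := F.preimage (eP.hom ≫ ModuleCat.ofHom f)
  have hp : Epi p := by
    have : Epi (ModuleCat.ofHom f) := (ModuleCat.epi_iff_surjective _).2 hf
    have : Epi (F.map p) := by rw [F.map_preimage]; infer_instance
    exact F.epi_of_epi_map this
  have := hfin P
  have := hfin (kernel p)
  have : Module.Projective A (F.obj P) := .of_equiv eP.symm.toLinearEquiv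
  have : Module.IsTorsionFree A (F.obj P) := inferInstance
  have : Module.IsTorsionFree A (F.obj (kernel p)) :=
    ((ModuleCat.mono_iff_injective (F.map (kernel.ι p))).1 inferInstance).moduleIsTorsionFree
      _ fun a x ↦ (F.map (kernel.ι p)).hom.map_smul a x
  have : Module.Projective A (F.obj (kernel p)) := Module.projective_of_isDedekindDomain
  exact ⟨.mk (kernel.ι p) p (kernel.condition p),
    { exact := ShortComplex.exact_of_f_is_kernel _ (kernelIsKernel p) },
    isSummandOfPower_of_projective e, isSummandOfPower_of_projective e, ⟨Iso.refl _⟩⟩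

variable [HasDerivedCategory C]

/-- The object `O` corresponding to the ring is a summand of a finite power of some homology object
of a strong generator `E`. So `O` lies in `⟨E⟩`, and `E` generates as fast as `O` does. -/
theorem step_two_eq_top_of_isStrongGenerator (hfin : ∀ M, Module.Finite A (F.obj M))
    (hess : ∀ N : ModuleCat.{u} A, Module.Finite A N → ∃ M, Nonempty (F.obj M ≅ N))
    {O : C} (e : F.obj O ≅ ModuleCat.of A A) {E : Bounded C} (hE : IsStrongGenerator E) :
    step E 2 = ⊤ := by
  have := projective_of_iso e
  obtain ⟨i, hi⟩ := exists_not_isTorsion_homology e hE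
  have := hfin ((homologyFunctor C i).obj E)
  have h : IsSummandOfPower ((homologyFunctor C i).obj E) O :=
    .of_map F ((ModuleCat.isSummandOfPower_of_not_isTorsion _ hi).of_iso (Iso.refl _) e.symm)
  refine top_le_iff.1 ((step_two_eq_top O (exists_resolution hfin hess e)).symm.le.trans
    (step_two_le (bracket_single_of_homology (fun M ↦ ?_) h 0)))
  obtain ⟨S, hS, h₁, h₂, e⟩ := exists_resolution hfin hess e M
  exact ⟨S, hS, h₁.projective, h₂.projective, e⟩

/-- Generation in the bounded derived category of an abelian category equivalent to that of finitely
generated modules over a Dedekind domain that is not a field. -/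
theorem dimensionSpectrum_eq_and_step (F : C ⥤ ModuleCat.{u} A) [F.Full] [F.Faithful] [F.Additive]
    [PreservesFiniteLimits F] [PreservesFiniteColimits F] (hA : ¬ IsField A)
    (hfin : ∀ M, Module.Finite A (F.obj M))
    (hess : ∀ N : ModuleCat.{u} A, Module.Finite A N → ∃ M, Nonempty (F.obj M ≅ N)) :
    dimensionSpectrum (Bounded C) = {1} ∧
      ∀ E : Bounded C, IsStrongGenerator E → step E 2 = ⊤ ∧ step E 1 ≠ ⊤ := by
  obtain ⟨O, ⟨e⟩⟩ := hess (.of A A) (inferInstanceAs (Module.Finite A A))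
  have := projective_of_iso e
  have h₁ := step_one_ne_top hA hfin hess
  have h₂ (E) (hE : IsStrongGenerator E) := step_two_eq_top_of_isStrongGenerator hfin hess e hE
  exact ⟨dimensionSpectrum_eq_singleton_one
    (step_two_eq_top O (exists_resolution hfin hess e)) h₁ h₂, fun E hE ↦ ⟨h₂ E hE, h₁ E⟩⟩

end DedekindGen

/-! ### Coherent sheaves on an affine scheme -/

namespace CoherentSheaf

open TopologicalSpace

/-- Global sections of a coherent sheaf, transported along the isomorphism of an affine scheme with
the spectrum of its ring of functions, are finitely generated. -/
theorem finite_moduleSpecΓ (X : Scheme.{u}) [IsAffine X] {M : X.Modules} (hM : isCoherent X M) :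
    Module.Finite Γ(X, ⊤)
      (moduleSpecΓFunctor.obj ((modulesEquiv X.isoSpec.symm).functor.obj M)) := by
  let f := X.isoSpec.inv
  have := hM.2 (f ''ᵁ ⊤) ((isAffineOpen_top _).image_of_isOpenImmersion f)
  let e : Γ(X, ⊤) ≃+* Γ(X, f ''ᵁ ⊤) :=
    ((Scheme.ΓSpecIso Γ(X, ⊤)).symm ≪≫ (f.appIso ⊤).symm).commRingCatIsoToRingEquiv
  have hsmul (r : Γ(X, ⊤)) (x : Γ(M.restrict f, ⊤)) :
      r • x = (M.restrictAppIso f ⊤).inv (e r • (M.restrictAppIso f ⊤).hom x) := by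
    have h : (Spec Γ(X, ⊤)).presheaf.map (Opens.leTop (⊤ : (Spec Γ(X, ⊤)).Opens)).op = 𝟙 _ :=
      (Spec Γ(X, ⊤)).presheaf.map_id _
    rw [Scheme.Modules.smul_Spec_def]
    exact congrArg (fun g ↦ (M.restrictAppIso f ⊤).inv ((f.appIso ⊤).inv
      (g ((Scheme.ΓSpecIso Γ(X, ⊤)).inv r)) • (M.restrictAppIso f ⊤).hom x)) h
  let φ : Γ(M, f ''ᵁ ⊤) →ₛₗ[(e.symm : Γ(X, f ''ᵁ ⊤) →+* Γ(X, ⊤))] Γ(M.restrict f, ⊤) :=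
    { (M.restrictAppIso f ⊤).inv.hom with
      map_smul' s x := by
        refine Eq.trans ?_ (hsmul (e.symm s) ((M.restrictAppIso f ⊤).inv x)).symm
        rw [e.apply_symm_apply]
        rfl }
  exact Module.Finite.of_surjective φ fun x ↦ ⟨(M.restrictAppIso f ⊤).hom x, rfl⟩

theorem isCoherent_of_epi {X : Scheme.{u}} {M N : X.Modules} (p : M ⟶ N) [Epi p]
    (hM : isCoherent X M) (hN : N.IsQuasicoherent) : isCoherent X N := by
  refine ⟨hN, fun U hU ↦ ?_⟩
  have := hM.2 U hU
  exact finite_of_surjective p (app_surjective p hM.1 hN hU)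

theorem isCoherent_unit (X : Scheme.{u}) [IsAffine X] :
    isCoherent X (SheafOfModules.unit X.ringCatSheaf) := by
  refine ⟨(isQuasicoherent_iff_Spec _).2 ?_,
    fun U _ ↦ inferInstanceAs (Module.Finite Γ(X, U) Γ(X, U))⟩
  exact isQuasicoherent_of_iso
    (tildeSelf ≪≫ (Scheme.Modules.restrictUnitIso X.isoSpec.inv).symm) inferInstance

variable (X : Scheme.{u}) [IsAffine X]

/-- The functor from modules over the ring of functions of an affine scheme to sheaves of modules. -/
noncomputable def tildeFunctor : ModuleCat.{u} Γ(X, ⊤) ⥤ X.Modules :=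
  tilde.functor Γ(X, ⊤) ⋙ (modulesEquiv X.isoSpec.symm).inverse

instance : PreservesFiniteColimits (tildeFunctor X) := by unfold tildeFunctor; infer_instance

instance : PreservesFiniteProducts (tildeFunctor X) := by unfold tildeFunctor; infer_instance

theorem isQuasicoherent_tildeFunctor (N : ModuleCat.{u} Γ(X, ⊤)) :
    ((tildeFunctor X).obj N).IsQuasicoherent :=
  Scheme.Modules.isQuasicoherent_restrictFunctor X.isoSpec.hom (tilde N)

variable [IsLocallyNoetherian X]

/-- The sheaf of a finitely generated module is a quotient of a finite power of the structure sheaf,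
hence coherent. -/
theorem isCoherent_tildeFunctor (N : ModuleCat.{u} Γ(X, ⊤)) [Module.Finite Γ(X, ⊤) N] :
    isCoherent X ((tildeFunctor X).obj N) := by
  obtain ⟨n, f, hf⟩ := Module.Finite.exists_fin' Γ(X, ⊤) N
  let R : ModuleCat.{u} Γ(X, ⊤) := .of _ Γ(X, ⊤)
  let O : X.Modules := SheafOfModules.unit X.ringCatSheaf
  let e : (tildeFunctor X).obj R ≅ O :=
    (modulesEquiv X.isoSpec.symm).inverse.mapIso tildeSelf ≪≫
      Scheme.Modules.restrictUnitIso X.isoSpec.hom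
  have hR : isCoherent X ((tildeFunctor X).obj R) :=
    isCoherent_of_epi e.inv (isCoherent_unit X) (isQuasicoherent_tildeFunctor X R)
  let e' : ∏ᶜ (fun _ : Fin n ↦ (tildeFunctor X).obj R) ≅
      (tildeFunctor X).obj (.of _ (Fin n → Γ(X, ⊤))) :=
    (PreservesProduct.iso (tildeFunctor X) fun _ : Fin n ↦ R).symm ≪≫
      (tildeFunctor X).mapIso (ModuleCat.piIsoPi _)
  have : Epi (ModuleCat.ofHom f) := (ModuleCat.epi_iff_surjective _).2 hf
  exact isCoherent_of_epi (e'.hom ≫ (tildeFunctor X).map (ModuleCat.ofHom f))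
    ((isCoherent X).prop_pi _ fun _ ↦ hR) (isQuasicoherent_tildeFunctor X N)

/-- Coherent sheaves on an affine Noetherian scheme, as quasi-coherent sheaves on the spectrum of its
ring of functions. -/
noncomputable def toQuasicoherent : Coh X ⥤
    (SheafOfModules.isQuasicoherent (Spec Γ(X, ⊤)).ringCatSheaf).FullSubcategory :=
  ObjectProperty.lift _ ((isCoherent X).ι ⋙ (modulesEquiv X.isoSpec.symm).functor)
    fun M ↦ (isQuasicoherent_iff_Spec _).1 M.2.1

instance : (toQuasicoherent X).Faithful where
  map_injective h := ObjectProperty.hom_ext _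
    ((modulesEquiv X.isoSpec.symm).functor.map_injective (congrArg (·.hom) h))

instance : (toQuasicoherent X).Full where
  map_surjective f :=
    ⟨ObjectProperty.homMk ((modulesEquiv X.isoSpec.symm).functor.preimage f.hom),
      ObjectProperty.hom_ext _ ((modulesEquiv X.isoSpec.symm).functor.map_preimage f.hom)⟩

/-- Global sections, from coherent sheaves on an affine Noetherian scheme `X` to finitely generated
modules over `Γ(X, ⊤)`. The sections are those of the sheaf transported to `Spec Γ(X, ⊤)`, where
`tildeEquiv` provides the module structure. -/
noncomputable def moduleFunctor : Coh X ⥤ FGModuleCat.{u} Γ(X, ⊤) :=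
  ObjectProperty.lift (ModuleCat.isFG Γ(X, ⊤))
    (toQuasicoherent X ⋙ (tildeEquiv (R := Γ(X, ⊤))).inverse)
    fun M ↦ (ModuleCat.isFG_iff _).2 (finite_moduleSpecΓ X M.2)

instance : (moduleFunctor X).Faithful := by
  unfold moduleFunctor; infer_instance

instance : (moduleFunctor X).Full := by
  unfold moduleFunctor; infer_instance

theorem exists_moduleFunctor_iso (N : ModuleCat.{u} Γ(X, ⊤)) [Module.Finite Γ(X, ⊤) N] :
    ∃ M : Coh X, Nonempty (((moduleFunctor X).obj M).obj ≅ N) := by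
  refine ⟨⟨_, isCoherent_tildeFunctor X N⟩, ⟨?_⟩⟩
  exact moduleSpecΓFunctor.mapIso
    ((modulesEquiv X.isoSpec.symm).counitIso.app ((tilde.functor Γ(X, ⊤)).obj N)) ≪≫
      (tilde.toTildeΓNatIso.app N).symm

instance : (moduleFunctor X).EssSurj where
  mem_essImage N := by
    obtain ⟨M, ⟨e⟩⟩ := exists_moduleFunctor_iso X N.obj
    exact ⟨M, ⟨ObjectProperty.isoMk _ e⟩⟩

instance : (moduleFunctor X).IsEquivalence where

end CoherentSheaf

theorem mainTheorem4 {k : Type u} [Field k] (C : SmoothAffineCurve k) :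
    TriangGen.dimensionSpectrum (CoherentSheaf.DbCoh C.toScheme) = {1} ∧
      ∀ E : CoherentSheaf.DbCoh C.toScheme, TriangGen.IsStrongGenerator E →
        TriangGen.step E 2 = ⊤ ∧ TriangGen.step E 1 ≠ ⊤ := by
  have := C.isDedekindDomain
  let F := CoherentSheaf.moduleFunctor C.toScheme ⋙
    forget₂ (FGModuleCat Γ(C.toScheme, ⊤)) (ModuleCat Γ(C.toScheme, ⊤))
  have : PreservesFiniteLimits F := comp_preservesFiniteLimits _ _
  have : PreservesFiniteColimits F := comp_preservesFiniteColimits _ _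
  have : F.Additive := Functor.additive_of_preserves_binary_products F
  exact DedekindGen.dimensionSpectrum_eq_and_step F C.not_isField
    (fun M ↦ ((CoherentSheaf.moduleFunctor C.toScheme).obj M).property)
    fun N _ ↦ CoherentSheaf.exists_moduleFunctor_iso C.toScheme N
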